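/- \textbf{Theorem.} Let $k$ be a complete non-Archimedean valued field such that $|k| = \{|x| : x \in k\}$ is dense in $\mathbb{R}_{\geq 0}$ and such that $k$ is not spherically complete (i.e. some decreasing sequence of closed balls of $k$ has empty intersection). Let $\kappa$ be either an infinite cardinal or the class of all cardinals (in which case "of cardinality $< \kappa$" is no restriction). Assume that $\kappa$ satisfies the non-measurability condition: no uncountable set of cardinality $< \kappa$ admits an $\omega_1$-complete non-principal ultrafilter. Let $\mathrm{Ban}(k)$ be the category of (non-Archimedean) Banach $k$-vector spaces, whose morphisms $V \to W$ are the bounded $k$-linear maps of operator norm $\leq 1$; its isomorphisms are the isometric $k$-linear isomorphisms. For a family $(W_i)_{i \in I}$ of Banach $k$-vector spaces, the bounded direct product $\Pi_I W$ is the space of families $(w_i)_{i \in I}$ with $w_i \in W_i$ and $\sup_i \|w_i\| < \infty$, with the supremum norm, and the completed direct sum $\Sigma_I W$ is its closed subspace of those families for which $\{i \in I : \|w_i\| \geq \varepsilon\}$ is finite for every $\varepsilon > 0$. Let $\mathscr{R}$ (the Reid class with respect to $\kappa$) be the smallest class of Banach $k$-vector spaces that contains $k$ and is closed under isomorphism in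 $\mathrm{Ban}(k)$ and under $\Pi_I$ and $\Sigma_I$ for all index sets $I$ of cardinality $< \kappa$; regard it as a full subcategory of $\mathrm{Ban}(k)$. Then the forgetful (inclusion) functor $\mathscr{R} \hookrightarrow \mathrm{Ban}(k)$ does not admit a left adjoint functor. -/

import Mathlib

open CategoryTheory Cardinal
open scoped ENNReal NNReal

universe u

noncomputable section

/-- Spherical completeness of a (non-Archimedean) metric space: every decreasing sequence of
closed balls has non-empty intersection. -/
def IsSphericallyComplete (X : Type*) [PseudoMetricSpace X] : Prop :=
  ∀ (x : ℕ → X) (r : ℕ → ℝ), (∀ n, 0 ≤ r n) →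
    Antitone (fun n => Metric.closedBall (x n) (r n)) →
    (⋂ n, Metric.closedBall (x n) (r n)).Nonempty

/-- A set `X` is `lam`-measurable if it is uncountable and carries a `lam`-complete
non-principal ultrafilter. -/
def IsMeasurableSetFor (lam : Cardinal.{u}) (X : Type u) : Prop :=
  Uncountable X ∧ ∃ F : Ultrafilter X,
    CardinalInterFilter (F : Filter X) lam ∧ ∀ x : X, F ≠ pure x

/-- `κ` is a cardinal or the class of all cardinals (the value `⊤`); the condition says that no set
of cardinality smaller than `κ` is `ω₁`-measurable. -/
def NonMeasurabilityCondition (κ : WithTop Cardinal.{u}) : Prop :=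
  ∀ I : Type u, ((#I : Cardinal.{u}) : WithTop Cardinal.{u}) < κ → ¬ IsMeasurableSetFor (ℵ_ 1) I

/-- A (non-Archimedean) Banach space over the valued field `k`. -/
structure BanCat (k : Type u) [NontriviallyNormedField k] : Type (u + 1) where
  of ::
  carrier : Type u
  [normedAddCommGroup : NormedAddCommGroup carrier]
  [normedSpace : NormedSpace k carrier]
  [completeSpace : CompleteSpace carrier]
  [isUltrametricDist : IsUltrametricDist carrier]

namespace BanCat

attribute [instance] BanCat.normedAddCommGroup BanCat.normedSpace BanCat.completeSpace
  BanCat.isUltrametricDist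

variable {k : Type u} [NontriviallyNormedField k]

instance : CoeSort (BanCat.{u} k) (Type u) := ⟨BanCat.carrier⟩

/-- Morphisms: bounded `k`-linear maps of operator norm at most one. -/
@[ext]
structure Hom (V W : BanCat.{u} k) : Type u where
  toCLM : V →L[k] W
  norm_le_one : ‖toCLM‖ ≤ 1

/-- The category of Banach `k`-vector spaces and bounded linear maps of operator norm at most one.
Its isomorphisms are the isometric linear isomorphisms. -/
instance : Category.{u} (BanCat.{u} k) where
  Hom V W := Hom V W
  id V := ⟨ContinuousLinearMap.id k V, ContinuousLinearMap.norm_id_le⟩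
  comp f g := ⟨g.toCLM.comp f.toCLM, (ContinuousLinearMap.opNorm_comp_le _ _).trans
    (mul_le_one₀ g.norm_le_one (norm_nonneg _) f.norm_le_one)⟩

variable {I : Type u} (W : I → BanCat.{u} k)

instance isUltrametricDist_lp : IsUltrametricDist (lp (fun i => (W i : Type u)) ∞) := by
  apply IsUltrametricDist.isUltrametricDist_of_forall_norm_add_le_max_norm
  intro f g
  refine lp.norm_le_of_forall_le (le_max_of_le_left (norm_nonneg _)) fun i => ?_
  exact (IsUltrametricDist.norm_add_le_max (f i) (g i)).trans
    (max_le_max (lp.norm_apply_le_norm (by simp) f i) (lp.norm_apply_le_norm (by simp) g i))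

/-- The bounded direct product of a family of Banach spaces, with the supremum norm. -/
def boundedProd : BanCat.{u} k := of (lp (fun i => (W i : Type u)) ∞)

/-- The subspace of the bounded direct product of the families `w` such that
`‖w i‖ < ε` for all but finitely many `i`, for each `ε > 0`. -/
def c0Submodule : Submodule k (lp (fun i => (W i : Type u)) ∞) where
  carrier := {w | ∀ ε : ℝ, 0 < ε → {i | ε ≤ ‖w i‖}.Finite}
  zero_mem' := by
    intro ε hε
    have h : {i | ε ≤ ‖(0 : lp (fun i => (W i : Type u)) ∞) i‖} = ∅ := by
      ext i; simp [hε]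
    rw [h]; exact Set.finite_empty
  add_mem' := by
    intro a b ha hb ε hε
    refine ((ha ε hε).union (hb ε hε)).subset fun i hi => ?_
    exact le_max_iff.1 (le_trans hi (IsUltrametricDist.norm_add_le_max (a i) (b i)))
  smul_mem' := by
    intro c w hw ε hε
    by_cases hc : c = 0
    · subst hc
      have h : {i | ε ≤ ‖((0 : k) • w) i‖} = ∅ := by
        ext i; simp [hε]
      rw [h]; exact Set.finite_empty
    · have hc' : 0 < ‖c‖ := norm_pos_iff.2 hc
      refine (hw (ε / ‖c‖) (div_pos hε hc')).subset fun i hi => ?_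
      have hi' : ε ≤ ‖c • w i‖ := hi
      rw [norm_smul] at hi'
      change ε / ‖c‖ ≤ ‖w i‖
      rw [div_le_iff₀ hc']
      linarith

theorem isClosed_c0Submodule : IsClosed (c0Submodule W : Set (lp (fun i => (W i : Type u)) ∞)) := by
  rw [← isSeqClosed_iff_isClosed]
  intro x p hx hp ε hε
  obtain ⟨n, hn⟩ := ((Metric.tendsto_nhds.1 hp) ε hε).exists
  refine (hx n ε hε).subset fun i hi => ?_
  by_contra hlt
  have h1 : ‖x n i‖ < ε := not_le.1 hlt
  have h2 : ‖(p - x n) i‖ < ε :=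
    (lp.norm_apply_le_norm (by simp) (p - x n) i).trans_lt (by rwa [← dist_eq_norm, dist_comm])
  have h3 : ‖p i‖ ≤ max ‖(p - x n) i‖ ‖x n i‖ := by
    simpa using IsUltrametricDist.norm_add_le_max ((p - x n) i) (x n i)
  exact absurd (lt_of_le_of_lt h3 (max_lt h2 h1)) (not_lt.2 hi)

instance completeSpace_c0Submodule : CompleteSpace (c0Submodule W) :=
  (isClosed_c0Submodule W).completeSpace_coe

instance isUltrametricDist_c0Submodule : IsUltrametricDist (c0Submodule W) :=
  ⟨fun x y z => IsUltrametricDist.dist_triangle_max (x : lp (fun i => (W i : Type u)) ∞) y z⟩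

/-- The completed direct sum of a family of Banach spaces, with the supremum norm. -/
def completedSum : BanCat.{u} k := of (c0Submodule W)

end BanCat

/-- The Reid class of Banach `k`-vector spaces with respect to `κ`: the smallest class
of Banach spaces that contains `k` and is closed under isometric isomorphism and under bounded
direct products and completed direct sums over index sets of cardinality smaller than `κ`. -/
inductive ReidClass (k : Type u) [NontriviallyNormedField k] [IsUltrametricDist k]
    [CompleteSpace k] (κ : WithTop Cardinal.{u}) : BanCat.{u} k → Prop
  | base : ReidClass k κ (BanCat.of k)
  | iso {V W : BanCat.{u} k} (e : V ≅ W) (hV : ReidClass k κ V) : ReidClass k κ W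
  | boundedProd (I : Type u) (hI : ((#I : Cardinal.{u}) : WithTop Cardinal.{u}) < κ)
      (W : I → BanCat.{u} k) (hW : ∀ i, ReidClass k κ (W i)) : ReidClass k κ (BanCat.boundedProd W)
  | completedSum (I : Type u) (hI : ((#I : Cardinal.{u}) : WithTop Cardinal.{u}) < κ)
      (W : I → BanCat.{u} k) (hW : ∀ i, ReidClass k κ (W i)) :
      ReidClass k κ (BanCat.completedSum W)

/-- The inclusion of the Reid class, as a full subcategory, into the category
of Banach `k`-vector spaces. -/
def reidForget (k : Type u) [NontriviallyNormedField k] [IsUltrametricDist k]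
    [CompleteSpace k] (κ : WithTop Cardinal.{u}) :
    ObjectProperty.FullSubcategory (ReidClass k κ) ⥤ BanCat.{u} k :=
  ObjectProperty.ι (ReidClass k κ)

end

/-! Suppose a left adjoint exists, and let `η : E ⟶ W` be its unit at a space `E`. As `k` is in the
Reid class, every functional of norm at most one on `E` factors uniquely through `η`. Functionals on
a Reid space separate points (`ReidClass.dualSeparates`). For finite-dimensional `E`, uniqueness
embeds the dual of `W` into that of `E`, so `W` is finite-dimensional
(`finiteDimensional_of_unique_extension`). On finite-dimensional Reid spaces norms are attained by
functionals (`ReidClass.attainsNorms`). Pulled back along `η`, this shows that for each `x : E` the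
supremum of `‖h x‖` over `‖h‖ ≤ 1` is attained. `exists_not_attaining` contradicts this: balls in
`k` with empty intersection give a norm on `k × k` for which the supremum at `(1, 0)` is 1 and is
not attained. -/

noncomputable section

/-! ### Functionals on spaces with coordinate projections -/

section Norming

variable {k : Type u} [NontriviallyNormedField k]

/-- A functional of norm at most one attains the norm of each vector. -/
def AttainsNorms (k : Type u) [NontriviallyNormedField k] (V : Type u) [NormedAddCommGroup V]
    [NormedSpace k V] : Prop :=
  ∀ w : V, ∃ f : V →L[k] k, ‖f‖ ≤ 1 ∧ ‖f w‖ = ‖w‖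

/-- The continuous functionals separate the points. -/
def DualSeparates (k : Type u) [NontriviallyNormedField k] (V : Type u) [NormedAddCommGroup V]
    [NormedSpace k V] : Prop :=
  ∀ w : V, w ≠ 0 → ∃ f : V →L[k] k, f w ≠ 0

theorem clm_comp_norm_le_one {U V W : Type u} [NormedAddCommGroup U] [NormedSpace k U]
    [NormedAddCommGroup V] [NormedSpace k V] [NormedAddCommGroup W] [NormedSpace k W]
    {f : V →L[k] W} {g : U →L[k] V} (hf : ‖f‖ ≤ 1) (hg : ‖g‖ ≤ 1) : ‖f.comp g‖ ≤ 1 :=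
  (ContinuousLinearMap.opNorm_comp_le _ _).trans (mul_le_one₀ hf (norm_nonneg _) hg)

variable {V : Type u} [NormedAddCommGroup V] [NormedSpace k V] {I : Type u} {W : I → Type u}
  [∀ i, NormedAddCommGroup (W i)] [∀ i, NormedSpace k (W i)]

theorem DualSeparates.of_projections (p : ∀ i, V →L[k] W i)
    (hle : ∀ v, (∀ i, p i v = 0) → v = 0) (h : ∀ i, DualSeparates k (W i)) :
    DualSeparates k V := by
  intro w hw
  obtain ⟨i, hi⟩ : ∃ i, p i w ≠ 0 := by
    by_contra! hcon
    exact hw (hle w hcon)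
  obtain ⟨f, hf⟩ := h i _ hi
  exact ⟨f.comp (p i), hf⟩

/-- The vectors `s i (p i v)` with `p i v ≠ 0` are linearly independent, because `p i` kills all of
them but the `i`-th. -/
theorem finite_support_of_finiteDimensional [FiniteDimensional k V] (p : ∀ i, V →L[k] W i)
    (s : ∀ i, W i →ₗ[k] V) (hps : ∀ i w, p i (s i w) = w)
    (hne : ∀ i j w, i ≠ j → p i (s j w) = 0) (v : V) : {i | p i v ≠ 0}.Finite := by
  have hli : LinearIndependent k (fun i : {i | p i v ≠ 0} => s i (p i v)) := by
    rw [linearIndependent_iff']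
    intro t g hg i hi
    have h := congrArg (p i) hg
    rw [map_sum, Finset.sum_eq_single i] at h
    · rw [map_smul, hps, map_zero, smul_eq_zero] at h
      exact h.resolve_right i.2
    · intro j _ hji
      rw [map_smul, hne _ _ _ (fun h => hji (Subtype.ext h.symm)), smul_zero]
    · exact fun h => absurd hi h
  have := hli.finite
  exact Set.toFinite _

/-- By finite support the supremum of the coordinate norms is a maximum, so a norming functional of
one largest coordinate, composed with the projection, norms the whole vector. -/
theorem AttainsNorms.of_projections (hV : FiniteDimensional k V) (p : ∀ i, V →L[k] W i)
    (s : ∀ i, W i →ₗ[k] V) (hps : ∀ i w, p i (s i w) = w)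
    (hne : ∀ i j w, i ≠ j → p i (s j w) = 0) (hp : ∀ i, ‖p i‖ ≤ 1)
    (hle : ∀ v (C : ℝ), 0 ≤ C → (∀ i, ‖p i v‖ ≤ C) → ‖v‖ ≤ C)
    (h : ∀ i, FiniteDimensional k (W i) → AttainsNorms k (W i)) : AttainsNorms k V := by
  intro w
  by_cases hw : w = 0
  · exact ⟨0, by simp, by simp [hw]⟩
  have hfin := finite_support_of_finiteDimensional p s hps hne w
  have hnon : {i | p i w ≠ 0}.Nonempty := by
    by_contra hcon
    have h0 : ∀ i, p i w = 0 := fun i => by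
      by_contra hi
      exact hcon ⟨i, hi⟩
    exact hw (norm_le_zero_iff.1 (hle w 0 le_rfl fun i => by simp [h0 i]))
  obtain ⟨i, -, hi⟩ := hfin.exists_maximalFor (fun i => ‖p i w‖) _ hnon
  have hmax : ‖w‖ ≤ ‖p i w‖ := by
    refine hle w _ (norm_nonneg _) fun j => ?_
    by_cases hj : p j w = 0
    · simp [hj]
    · rcases le_total ‖p i w‖ ‖p j w‖ with h1 | h1
      · exact hi hj h1
      · exact h1
  have : FiniteDimensional k (W i) :=
    Module.Finite.of_injective (s i) (Function.LeftInverse.injective (hps i))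
  obtain ⟨f, hf, hfw⟩ := h i inferInstance (p i w)
  refine ⟨f.comp (p i), clm_comp_norm_le_one hf (hp i), ?_⟩
  rw [ContinuousLinearMap.comp_apply, hfw]
  exact le_antisymm ((p i).le_of_opNorm_le (hp i) w |>.trans (by simp)) hmax

end Norming

/-! ### Duals of Reid spaces -/

section Reid

variable {k : Type u} [NontriviallyNormedField k]

namespace BanCat

variable {I : Type u} (W : I → BanCat.{u} k)

/-- The coordinate projections of the bounded direct product. -/
def boundedProdProj (i : I) : lp (fun i => (W i : Type u)) ∞ →L[k] W i :=
  LinearMap.mkContinuous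
    { toFun := fun w => w i, map_add' := fun _ _ => rfl, map_smul' := fun _ _ => rfl } 1
    fun w => (lp.norm_apply_le_norm (by simp) w i).trans_eq (one_mul _).symm

theorem norm_boundedProdProj_le (i : I) : ‖boundedProdProj W i‖ ≤ 1 :=
  LinearMap.mkContinuous_norm_le _ zero_le_one _

open scoped Classical in
/-- The coordinate inclusions into the bounded direct product. -/
def boundedProdIncl (i : I) : W i →ₗ[k] lp (fun i => (W i : Type u)) ∞ where
  toFun w := lp.single ∞ i w
  map_add' a b := map_add (lp.singleAddMonoidHom (E := fun i => (W i : Type u)) ∞ i) a b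
  map_smul' c a := lp.single_smul (E := fun i => (W i : Type u)) ∞ i c a

theorem boundedProdIncl_self (i : I) (w : W i) : boundedProdIncl W i w i = w := by
  classical
  exact lp.single_apply_self (E := fun i => (W i : Type u)) ∞ i w

theorem boundedProdIncl_of_ne {i j : I} (h : i ≠ j) (w : W j) : boundedProdIncl W j w i = 0 := by
  classical
  exact lp.single_apply_ne (E := fun i => (W i : Type u)) ∞ j w h

theorem boundedProdIncl_mem (i : I) (w : W i) : boundedProdIncl W i w ∈ c0Submodule W := by
  intro ε hε
  refine (Set.finite_singleton i).subset fun j hj => ?_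
  by_contra hne
  have h : ε ≤ ‖boundedProdIncl W i w j‖ := hj
  rw [boundedProdIncl_of_ne W hne, norm_zero] at h
  exact absurd h (not_le.2 hε)

theorem norm_inv_apply {V W : BanCat.{u} k} (e : V ≅ W) (w : W) : ‖e.inv.toCLM w‖ = ‖w‖ := by
  refine le_antisymm ((e.inv.toCLM.le_of_opNorm_le e.inv.norm_le_one w).trans (by simp)) ?_
  have h : e.hom.toCLM (e.inv.toCLM w) = w :=
    congrArg (fun f : W ⟶ W => f.toCLM w) e.inv_hom_id
  calc ‖w‖ = ‖e.hom.toCLM (e.inv.toCLM w)‖ := by rw [h]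
    _ ≤ 1 * ‖e.inv.toCLM w‖ := e.hom.toCLM.le_of_opNorm_le e.hom.norm_le_one _
    _ = _ := one_mul _

end BanCat

open BanCat

variable [IsUltrametricDist k] [CompleteSpace k] {κ : WithTop Cardinal.{u}}

theorem ReidClass.dualSeparates {V : BanCat.{u} k} (hV : ReidClass k κ V) :
    DualSeparates k V := by
  induction hV with
  | base => exact fun w hw => ⟨ContinuousLinearMap.id k k, hw⟩
  | @iso V W e _ ih =>
    exact DualSeparates.of_projections (I := PUnit) (W := fun _ => V) (fun _ => e.inv.toCLM)
      (fun v hv => norm_eq_zero.1 (by rw [← norm_inv_apply e, hv ⟨⟩, norm_zero])) fun _ => ih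
  | boundedProd I _ W _ ih =>
    exact DualSeparates.of_projections (V := lp (fun i => (W i : Type u)) ∞) (boundedProdProj W)
      (fun v hv => lp.ext (funext hv)) ih
  | completedSum I _ W _ ih =>
    exact DualSeparates.of_projections (V := c0Submodule W)
      (fun i => (boundedProdProj W i).comp (c0Submodule W).subtypeL)
      (fun v hv => Subtype.ext (lp.ext (funext hv))) ih

theorem ReidClass.attainsNorms {V : BanCat.{u} k} (hV : ReidClass k κ V)
    (hfd : FiniteDimensional k V) : AttainsNorms k V := by
  induction hV with
  | base => exact fun w => ⟨ContinuousLinearMap.id k k, ContinuousLinearMap.norm_id_le, rfl⟩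
  | @iso V W e _ ih =>
    have hinj : Function.Injective e.hom.toCLM := fun a b hab => by
      have h : ∀ v, e.inv.toCLM (e.hom.toCLM v) = v := fun v =>
        congrArg (fun f : V ⟶ V => f.toCLM v) e.hom_inv_id
      rw [← h a, hab, h b]
    have := Module.Finite.of_injective (e.hom.toCLM : V →ₗ[k] W) hinj
    intro w
    obtain ⟨f, hf, hfw⟩ := ih this (e.inv.toCLM w)
    exact ⟨f.comp e.inv.toCLM, clm_comp_norm_le_one hf e.inv.norm_le_one,
      hfw.trans (norm_inv_apply e w)⟩
  | boundedProd I _ W _ ih =>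
    exact AttainsNorms.of_projections (V := lp (fun i => (W i : Type u)) ∞) hfd (boundedProdProj W)
      (boundedProdIncl W) (boundedProdIncl_self W) (fun _ _ w h => boundedProdIncl_of_ne W h w)
      (norm_boundedProdProj_le W) (fun _ _ hC h => lp.norm_le_of_forall_le hC h) ih
  | completedSum I _ W _ ih =>
    exact AttainsNorms.of_projections (V := c0Submodule W) hfd
      (fun i => (boundedProdProj W i).comp (c0Submodule W).subtypeL)
      (fun i => (boundedProdIncl W i).codRestrict _ (boundedProdIncl_mem W i))
      (boundedProdIncl_self W) (fun _ _ w h => boundedProdIncl_of_ne W h w)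
      (fun i => clm_comp_norm_le_one (norm_boundedProdProj_le W i)
        (Submodule.norm_subtypeL_le _))
      (fun _ _ hC h => lp.norm_le_of_forall_le hC h) ih

/-- A morphism from a finite-dimensional space through which all functionals of norm at most one
factor uniquely has a finite-dimensional target, if the functionals on the target separate
points. -/
theorem finiteDimensional_of_unique_extension {E W : BanCat.{u} k} [FiniteDimensional k E]
    (η : E ⟶ W) (huniq : ∀ g g' : W ⟶ BanCat.of k, η ≫ g = η ≫ g' → g = g')
    (hsep : DualSeparates k W) : FiniteDimensional k W := by
  have hinj : ∀ g : W →L[k] k, g.comp η.toCLM = 0 → g = 0 := by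
    intro g hg
    -- Uniqueness is available only for functionals of norm at most one, so `g` is scaled into the
    -- unit ball.
    obtain ⟨c, hc, hcg⟩ : ∃ c : k, c ≠ 0 ∧ ‖c • g‖ ≤ 1 := by
      obtain ⟨c, hc, hcn⟩ := NormedField.exists_norm_lt k (inv_pos.2 (by positivity : 0 < ‖g‖ + 1))
      refine ⟨c, norm_pos_iff.1 hc, ?_⟩
      rw [norm_smul]
      calc ‖c‖ * ‖g‖ ≤ (‖g‖ + 1)⁻¹ * (‖g‖ + 1) := by gcongr; linarith
        _ = 1 := inv_mul_cancel₀ (by positivity)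
    have h := huniq ⟨c • g, hcg⟩ ⟨0, by simp⟩ (BanCat.Hom.ext (by
      change (c • g).comp η.toCLM = (0 : W →L[k] k).comp η.toCLM
      refine ContinuousLinearMap.ext fun x => ?_
      have hx : g (η.toCLM x) = 0 := congrArg (fun f : E →L[k] k => f x) hg
      change c * g (η.toCLM x) = 0
      rw [hx, mul_zero]))
    have h' : c • g = 0 := congrArg BanCat.Hom.toCLM h
    exact (smul_eq_zero.1 h').resolve_left hc
  let D : (W →L[k] k) →ₗ[k] Module.Dual k E :=
    { toFun := fun g => (g.comp η.toCLM : E →L[k] k)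
      map_add' := fun _ _ => rfl
      map_smul' := fun _ _ => rfl }
  have : FiniteDimensional k (W →L[k] k) := Module.Finite.of_injective D <| by
    rw [← LinearMap.ker_eq_bot, LinearMap.ker_eq_bot']
    exact fun g hg => hinj g (ContinuousLinearMap.ext fun x => LinearMap.congr_fun hg x)
  -- Separation of points makes evaluation into the finite-dimensional bidual injective.
  let ev : W →ₗ[k] Module.Dual k (W →L[k] k) :=
    { toFun := fun w => { toFun := fun g => g w, map_add' := fun _ _ => rfl,
                          map_smul' := fun _ _ => rfl }
      map_add' := fun a b => LinearMap.ext fun g => map_add g a b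
      map_smul' := fun c a => LinearMap.ext fun g => map_smul g c a }
  refine Module.Finite.of_injective ev ?_
  rw [← LinearMap.ker_eq_bot, LinearMap.ker_eq_bot']
  intro w hw
  by_contra hne
  obtain ⟨f, hf⟩ := hsep w hne
  exact hf (LinearMap.congr_fun hw f)

end Reid

/-! ### The limit norm on the plane -/

section Plane

variable {k : Type u} [NontriviallyNormedField k]

/-- Dividing by a nonzero second coordinate reduces to vectors `(a, 1)`, which are the hypothesis.
-/
theorem eventually_norm_const {c : ℕ → k} (hc : ∀ a, ∃ r > 0, ∀ᶠ n in Filter.atTop, ‖a + c n‖ = r)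
    (v : k × k) : ∃ r, 0 ≤ r ∧ (r = 0 → v = 0) ∧
      ∀ᶠ n in Filter.atTop, ‖v.1 + v.2 * c n‖ = r := by
  by_cases hb : v.2 = 0
  · exact ⟨‖v.1‖, norm_nonneg _, fun h => Prod.ext (norm_eq_zero.1 h) hb, by simp [hb]⟩
  · obtain ⟨r, hr, h⟩ := hc (v.1 / v.2)
    have hb' : 0 < ‖v.2‖ := norm_pos_iff.2 hb
    refine ⟨‖v.2‖ * r, by positivity, fun h => absurd h (by positivity), ?_⟩
    filter_upwards [h] with n hn
    rw [← hn, ← norm_mul, mul_add, mul_div_cancel₀ _ hb]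

/-- The norm `lim ‖a + b * c n‖` on `k × k`, for a sequence `c` that is pseudo-convergent without
pseudo-limit. -/
def limNorm {c : ℕ → k} (hc : ∀ a, ∃ r > 0, ∀ᶠ n in Filter.atTop, ‖a + c n‖ = r)
    (v : k × k) : ℝ :=
  (eventually_norm_const hc v).choose

variable {c : ℕ → k} (hc : ∀ a, ∃ r > 0, ∀ᶠ n in Filter.atTop, ‖a + c n‖ = r)

theorem eventually_eq_limNorm (v : k × k) :
    ∀ᶠ n in Filter.atTop, ‖v.1 + v.2 * c n‖ = limNorm hc v :=
  (eventually_norm_const hc v).choose_spec.2.2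

theorem limNorm_add_le_max [IsUltrametricDist k] (v w : k × k) :
    limNorm hc (v + w) ≤ max (limNorm hc v) (limNorm hc w) := by
  obtain ⟨n, h1, h2, h3⟩ := ((eventually_eq_limNorm hc v).and
    ((eventually_eq_limNorm hc w).and (eventually_eq_limNorm hc (v + w)))).exists
  rw [← h1, ← h2, ← h3]
  have h : (v + w).1 + (v + w).2 * c n = (v.1 + v.2 * c n) + (w.1 + w.2 * c n) := by
    simp only [Prod.fst_add, Prod.snd_add]; ring
  rw [h]
  exact IsUltrametricDist.norm_add_le_max _ _

theorem limNorm_smul (a : k) (v : k × k) : limNorm hc (a • v) = ‖a‖ * limNorm hc v := by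
  obtain ⟨n, h1, h2⟩ := ((eventually_eq_limNorm hc v).and
    (eventually_eq_limNorm hc (a • v))).exists
  rw [← h1, ← h2, ← norm_mul]
  simp only [Prod.smul_fst, Prod.smul_snd, smul_eq_mul]
  ring_nf

variable [IsUltrametricDist k]

/-- `limNorm` as a bundled norm. -/
def limAddGroupNorm : AddGroupNorm (k × k) where
  toFun := limNorm hc
  map_zero' := by simpa using limNorm_smul hc 0 0
  add_le' v w := (limNorm_add_le_max hc v w).trans
    (max_le_add_of_nonneg (eventually_norm_const hc v).choose_spec.1
      (eventually_norm_const hc w).choose_spec.1)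
  neg' v := by simpa using limNorm_smul hc (-1) v
  eq_zero_of_map_eq_zero' v h := (eventually_norm_const hc v).choose_spec.2.1 h

/-- The plane `k × k`, to be given the norm `limNorm`. -/
def LimPlane (_ : ∀ a, ∃ r > 0, ∀ᶠ n in Filter.atTop, ‖a + c n‖ = r) : Type u := k × k

instance : NormedAddCommGroup (LimPlane hc) := (limAddGroupNorm hc).toNormedAddCommGroup

instance : Module k (LimPlane hc) := inferInstanceAs (Module k (k × k))

instance : NormedSpace k (LimPlane hc) := ⟨fun a v => (limNorm_smul hc a v).le⟩

instance : FiniteDimensional k (LimPlane hc) := inferInstanceAs (FiniteDimensional k (k × k))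

instance : IsUltrametricDist (LimPlane hc) :=
  IsUltrametricDist.isUltrametricDist_of_forall_norm_add_le_max_norm (limNorm_add_le_max hc)

instance [CompleteSpace k] : CompleteSpace (LimPlane hc) := FiniteDimensional.complete k _

end Plane

/-! ### Empty intersections of balls and a supremum that is not attained -/

section Balls

variable {k : Type u} [NontriviallyNormedField k]

theorem exists_norm_between (hdense : Dense (Set.range (fun x : k => ‖x‖₊))) {s t : ℝ}
    (hs : 0 ≤ s) (hst : s < t) : ∃ x : k, s < ‖x‖ ∧ ‖x‖ < t := by
  lift s to ℝ≥0 using hs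
  lift t to ℝ≥0 using s.2.trans hst.le
  obtain ⟨_, ⟨x, rfl⟩, h⟩ := hdense.exists_between (NNReal.coe_lt_coe.1 hst)
  exact ⟨x, NNReal.coe_lt_coe.2 h.1, NNReal.coe_lt_coe.2 h.2⟩

variable [IsUltrametricDist k]

theorem norm_sub_le_max_norm (a b : k) : ‖a - b‖ ≤ max ‖a‖ ‖b‖ := by
  simpa [sub_eq_add_neg] using IsUltrametricDist.norm_add_le_max a (-b)

/-- If `r m < r n`, density gives `y` with `r m < ‖y‖ < r n`. Both `c n` and `c n + y` lie in the
larger-indexed ball, hence in the `m`-th, which forces `‖y‖ ≤ r m`. -/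
theorem antitone_radius_of_antitone_closedBall
    (hdense : Dense (Set.range (fun x : k => ‖x‖₊))) {c : ℕ → k} {r : ℕ → ℝ}
    (hr : ∀ n, 0 ≤ r n) (hanti : Antitone fun n => Metric.closedBall (c n) (r n)) :
    Antitone r := by
  intro m n hmn
  by_contra! hlt
  obtain ⟨y, h1, h2⟩ := exists_norm_between hdense (hr m) hlt
  have ha : ‖c n + y - c m‖ ≤ r m :=
    mem_closedBall_iff_norm.1 (hanti hmn (mem_closedBall_iff_norm.2 (by simpa using h2.le)))
  have hb : ‖c n - c m‖ ≤ r m :=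
    mem_closedBall_iff_norm.1 (hanti hmn (Metric.mem_closedBall_self (hr n)))
  have hy : ‖y‖ ≤ max ‖c n + y - c m‖ ‖c n - c m‖ := by
    have := norm_sub_le_max_norm (c n + y - c m) (c n - c m)
    simpa using this
  exact absurd (hy.trans (max_le ha hb)) (not_le.2 h1)

/-- Over a densely valued field that is not spherically complete, some finite-dimensional space has
a vector on which the functionals of norm at most one do not attain their supremum. -/
theorem exists_not_attaining [CompleteSpace k]
    (hdense : Dense (Set.range (fun x : k => ‖x‖₊))) (hsph : ¬ IsSphericallyComplete k) :
    ∃ (E : BanCat.{u} k) (_ : FiniteDimensional k E) (x : E),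
      (∀ s < (1 : ℝ), ∃ h : E →L[k] k, ‖h‖ ≤ 1 ∧ s ≤ ‖h x‖) ∧
      ∀ h : E →L[k] k, ‖h‖ ≤ 1 → ‖h x‖ < 1 := by
  unfold IsSphericallyComplete at hsph
  push Not at hsph
  obtain ⟨c, r, hr, hanti, hempty⟩ := hsph
  have hranti := antitone_radius_of_antitone_closedBall hdense hr hanti
  have hball : ∀ {m n}, m ≤ n → ‖c n - c m‖ ≤ r m := fun {m n} hmn =>
    mem_closedBall_iff_norm.1 (hanti hmn (Metric.mem_closedBall_self (hr n)))
  have hout : ∀ a : k, ∃ N, r N < ‖a - c N‖ := by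
    intro a
    by_contra! hcon
    have : a ∈ ⋂ n, Metric.closedBall (c n) (r n) :=
      Set.mem_iInter.2 fun n => mem_closedBall_iff_norm.2 (hcon n)
    rw [hempty] at this
    exact this
  -- Once `-a` is outside the `N`-th ball, all later centres are closer to `c N` than `-a` is, so
  -- the ultrametric inequality freezes the distance.
  have hout' : ∀ a : k, ∃ N, r N < ‖a + c N‖ ∧ ∀ n ≥ N, ‖a + c n‖ = ‖a + c N‖ := by
    intro a
    obtain ⟨N, hN⟩ := hout (-a)
    have hN' : r N < ‖a + c N‖ := by rwa [← norm_neg, neg_sub, sub_neg_eq_add, add_comm] at hN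
    refine ⟨N, hN', fun n hn => ?_⟩
    have hlt : ‖c n - c N‖ < ‖a + c N‖ := (hball hn).trans_lt hN'
    have h := IsUltrametricDist.norm_add_eq_max_of_norm_ne_norm hlt.ne'
    rw [max_eq_left hlt.le] at h
    rw [← h]
    congr 1
    ring
  have hc : ∀ a, ∃ r > 0, ∀ᶠ n in Filter.atTop, ‖a + c n‖ = r := by
    intro a
    obtain ⟨N, h1, h2⟩ := hout' a
    exact ⟨_, (hr N).trans_lt h1, Filter.eventually_atTop.2 ⟨N, h2⟩⟩
  -- The infimum of the radii is positive, by completeness.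
  have hbdd : BddBelow (Set.range r) := ⟨0, by rintro _ ⟨n, rfl⟩; exact hr n⟩
  have hlim := tendsto_atTop_ciInf hranti hbdd
  set ρ := ⨅ n, r n with hρ
  have hρle : ∀ n, ρ ≤ r n := fun n => ciInf_le hbdd n
  have hρpos : 0 < ρ := by
    refine lt_of_le_of_ne (le_ciInf hr) fun h0 => ?_
    rw [← h0] at hlim
    have hcau : CauchySeq c := cauchySeq_of_le_tendsto_0 r (fun n m N hn hm => by
      rw [dist_eq_norm, ← sub_sub_sub_cancel_right _ _ (c N)]
      exact (norm_sub_le_max_norm _ _).trans (max_le (hball hn) (hball hm))) hlim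
    obtain ⟨a, ha⟩ := cauchySeq_tendsto_of_complete hcau
    obtain ⟨N, hN⟩ := hout a
    refine absurd ?_ (not_le.2 hN)
    exact le_of_tendsto ((ha.sub_const (c N)).norm)
      (Filter.eventually_atTop.2 ⟨N, fun n hn => hball hn⟩)
  have hlow : ∀ a b : k, ‖b‖ * ρ ≤ limNorm hc (a, b) := by
    intro a b
    by_cases hb : b = 0
    · rw [hb, norm_zero, zero_mul]
      exact (eventually_norm_const hc (a, 0)).choose_spec.1
    obtain ⟨N, h1, h2⟩ := hout' (a / b)
    obtain ⟨n, hn, hnN⟩ := ((eventually_eq_limNorm hc (a, b)).and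
      (Filter.eventually_ge_atTop N)).exists
    rw [← hn, show a + b * c n = b * (a / b + c n) by rw [mul_add, mul_div_cancel₀ _ hb], norm_mul,
      h2 n hnN]
    gcongr
    exact (hρle N).trans h1.le
  let x : LimPlane hc := ((1, 0) : k × k)
  refine ⟨BanCat.of (LimPlane hc), inferInstanceAs (FiniteDimensional k (LimPlane hc)), x, ?_, ?_⟩
  · intro s hs
    rcases le_or_gt s 0 with hs0 | hs0
    · exact ⟨0, by simp, by simpa using hs0⟩
    -- The functional is `(a, b) ↦ l * (a + b * c n)`, with value `l` at `x`. Replacing `c n` by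
    -- later centres costs at most `‖b‖ * r n`; the factor `‖l‖ < 1` brings this below `‖b‖ * ρ`,
    -- which `hlow` bounds by the norm.
    obtain ⟨l, hl1, hl2⟩ := exists_norm_between hdense hs0.le hs
    have hl0 : 0 < ‖l‖ := hs0.trans hl1
    obtain ⟨n, hn⟩ := (hlim.eventually (gt_mem_nhds
      (show ρ < ρ / ‖l‖ from (lt_div_iff₀ hl0).2 (by nlinarith)))).exists
    rw [lt_div_iff₀ hl0] at hn
    let f : LimPlane hc →ₗ[k] k :=
      { toFun := fun v => l * ((v : k × k).1 + (v : k × k).2 * c n)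
        map_add' := fun v w => by
          change l * (((v : k × k).1 + (w : k × k).1) + ((v : k × k).2 + (w : k × k).2) * c n) = _
          ring
        map_smul' := fun a v => by
          change l * ((a * (v : k × k).1) + (a * (v : k × k).2) * c n) = a * _
          ring }
    refine ⟨f.mkContinuous 1 fun v => ?_, f.mkContinuous_norm_le zero_le_one _, ?_⟩
    · obtain ⟨a, b⟩ := (v : k × k)
      rw [one_mul]
      change ‖l * (a + b * c n)‖ ≤ limNorm hc (a, b)
      obtain ⟨m, hm, hmn⟩ := ((eventually_eq_limNorm hc (a, b)).and
        (Filter.eventually_ge_atTop n)).exists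
      have h1 : ‖a + b * c n‖ ≤ max ‖a + b * c m‖ ‖b * (c m - c n)‖ := by
        have := norm_sub_le_max_norm (a + b * c m) (b * (c m - c n))
        rwa [show a + b * c m - b * (c m - c n) = a + b * c n by ring] at this
      rw [norm_mul]
      rcases le_max_iff.1 h1 with h | h
      · calc ‖l‖ * ‖a + b * c n‖ ≤ 1 * ‖a + b * c m‖ := by gcongr
          _ = limNorm hc (a, b) := by rw [one_mul]; exact hm
      · calc ‖l‖ * ‖a + b * c n‖ ≤ ‖l‖ * (‖b‖ * r n) := by
              gcongr
              rw [norm_mul] at h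
              exact h.trans (by gcongr; exact hball hmn)
          _ = ‖b‖ * (r n * ‖l‖) := by ring
          _ ≤ ‖b‖ * ρ := by gcongr
          _ ≤ _ := hlow a b
    · change s ≤ ‖l * ((1 : k) + 0 * c n)‖
      simpa using hl1.le
  · intro h hh
    by_contra! h1
    let y : LimPlane hc := ((0, 1) : k × k)
    have h1' : (1 : ℝ) ≤ ‖h x‖ := h1
    have hx0 : h x ≠ 0 := norm_pos_iff.1 (zero_lt_one.trans_le h1')
    -- If `‖h x‖ ≥ 1`, then `‖y - c N • x‖ ≤ r N` would place `h y / h x` in every ball.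
    obtain ⟨N, hN⟩ := hout (h y / h x)
    have hv : h (y - c N • x) = h x * (h y / h x - c N) := by
      rw [map_sub, map_smul, mul_sub, mul_div_cancel₀ _ hx0, smul_eq_mul, mul_comm]
    have hnorm : ‖y - c N • x‖ ≤ r N := by
      change limNorm hc (((0, 1) : k × k) - c N • ((1, 0) : k × k)) ≤ r N
      obtain ⟨m, hm, hmN⟩ := ((eventually_eq_limNorm hc
        (((0, 1) : k × k) - c N • ((1, 0) : k × k))).and (Filter.eventually_ge_atTop N)).exists
      rw [← hm]
      simpa [neg_add_eq_sub] using hball hmN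
    have hle := (h.le_of_opNorm_le hh (y - c N • x)).trans_eq (one_mul _)
    rw [hv, norm_mul] at hle
    nlinarith [norm_nonneg (h y / h x - c N)]

end Balls

end

/-! ### Contradiction from the adjunction -/

theorem mainTheorem7 (k : Type u) [NontriviallyNormedField k] [IsUltrametricDist k]
    [CompleteSpace k] (hdense : Dense (Set.range (fun x : k => ‖x‖₊)))
    (hsph : ¬ IsSphericallyComplete k)
    (κ : WithTop Cardinal.{u}) (hκ : ((ℵ₀ : Cardinal.{u}) : WithTop Cardinal.{u}) ≤ κ)
    (hmeas : NonMeasurabilityCondition κ) :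
    ¬ (reidForget k κ).IsRightAdjoint := by
  intro hadj
  obtain ⟨E, hE, x, hsup, hlt⟩ := exists_not_attaining hdense hsph
  let adj := Adjunction.ofIsRightAdjoint (reidForget k κ)
  let W := (reidForget k κ).leftAdjoint.obj E
  let K : ObjectProperty.FullSubcategory (ReidClass k κ) := ⟨BanCat.of k, ReidClass.base⟩
  let η : E ⟶ W.obj := adj.unit.app E
  have huniq : ∀ g g' : W.obj ⟶ BanCat.of k, η ≫ g = η ≫ g' → g = g' := by
    intro g g' h
    have h' : (⟨g⟩ : W ⟶ K) = ⟨g'⟩ := by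
      apply (adj.homEquiv E K).injective
      rw [adj.homEquiv_unit, adj.homEquiv_unit]
      exact h
    exact congrArg (fun f : W ⟶ K => f.hom) h'
  have hext : ∀ f : E ⟶ BanCat.of k, ∃ g : W.obj ⟶ BanCat.of k, η ≫ g = f := by
    intro f
    refine ⟨((adj.homEquiv E K).symm f).hom, ?_⟩
    have h := (adj.homEquiv E K).apply_symm_apply f
    rw [adj.homEquiv_unit] at h
    exact h
  have hfd := finiteDimensional_of_unique_extension η huniq W.property.dualSeparates
  obtain ⟨f, hf, hfx⟩ := W.property.attainsNorms hfd (η.toCLM x)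
  refine absurd ?_ (not_le.2 (hlt (f.comp η.toCLM) (clm_comp_norm_le_one hf η.norm_le_one)))
  -- Every `h` with `‖h‖ ≤ 1` extends along `η` without increase of norm bound, so `‖h x‖ ≤ ‖η x‖`;
  -- letting `s` tend to 1 gives `1 ≤ ‖η x‖ = ‖f (η x)‖`.
  refine le_of_forall_lt_imp_le_of_dense fun s hs => ?_
  obtain ⟨h, hh, hsx⟩ := hsup s hs
  obtain ⟨g, hg⟩ := hext ⟨h, hh⟩
  have hgx : g.toCLM (η.toCLM x) = h x := congrArg (fun f : E ⟶ BanCat.of k => f.toCLM x) hg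
  calc s ≤ ‖g.toCLM (η.toCLM x)‖ := by rw [hgx]; exact hsx
    _ ≤ 1 * ‖η.toCLM x‖ := g.toCLM.le_of_opNorm_le g.norm_le_one _
    _ = ‖f (η.toCLM x)‖ := by rw [one_mul, hfx]
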